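/- Let $\mathcal S_+^{\rm mon}$ denote the set of Schwartz functions $\rho:\mathbb R\to\mathbb R$ with $\rho(x)>0$ for all $x\in\mathbb R$ for which there is $K>0$ with $x\,\rho'(x)\le 0$ whenever $|x|>K$. For $\rho\in\mathcal S_+^{\rm mon}$ and $\alpha\in\mathbb N=\{1,2,\dots\}$, let $W^{\alpha,2}_\rho(\mathbb R)$ be the space of functions $f:\mathbb R\to\mathbb C$ having weak derivatives $f^{(\tau)}$, $0\le\tau\le\alpha$, with $$\|f\|_{W^{\alpha,2}_\rho(\mathbb R)}=\Big(\sum_{\tau=0}^{\alpha}\int_{\mathbb R}|f^{(\tau)}(x)|^2\rho(x)\,\mathrm dx\Big)^{1/2}<\infty .$$ Let $W^{\alpha,2}_{\rm per}(0,2\pi)$ be the space of functions $g$ on $(0,2\pi)$ whose weak derivatives $g^{(\tau)}$, $0\le\tau\le\alpha$, on $(0,2\pi)$ exist and belong to $L^2(0,2\pi)$, and which satisfy $g^{(\tau)}(0)=g^{(\tau)}(2\pi)$ for $0\le\tau\le\alpha-1$, where the point values are those of the representative of $g^{(\tau)}$ that is continuous on $[0,2\pi]$. Fix $c>0$ and set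 $\phi(\theta)=-c\cot(\theta/2)$ for $\theta\in(0,2\pi)$. Let $\rho\in\mathcal S_+^{\rm mon}$. Then for every integer $\tau\ge 0$ there is a constant $C_{\rho,\tau}>0$ (which may also depend on the fixed $c$) such that for all $\alpha\in\mathbb N$ with $\alpha\ge\tau$ and all $f\in W^{\alpha,2}_\rho(\mathbb R)$ the function $$g=\big((f\rho)\circ\phi\big)\,\phi'$$ on $(0,2\pi)$ has a weak derivative $g^{(\tau)}$ of order $\tau$, and $$\|g^{(\tau)}\|_{L^2(0,2\pi)}\le C_{\rho,\tau}\,\|f\|_{W^{\alpha,2}_\rho(\mathbb R)} .$$ Moreover, for all $\alpha\in\mathbb N$, all $f\in W^{\alpha,2}_\rho(\mathbb R)$ and all $\tau=0,\dots,\alpha-1$, the weak derivative $g^{(\tau)}$ has a continuous representative on $(0,2\pi)$, and this representative satisfies $$\lim_{\theta\to0^+}g^{(\tau)}(\theta)=\lim_{\theta\to2\pi^-}g^{(\tau)}(\theta)=0 .$$ In consequence, $g\in W^{\alpha,2}_{\rm per}(0,2\pi)$. -/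

import Mathlib

open MeasureTheory Set Filter Topology
open scoped ContDiff SchwartzMap

noncomputable section

/-- Positive Schwartz functions on the real line that are nondecreasing near `-∞` and
nonincreasing near `+∞`. -/
def IsMonotonicSchwartzWeight (ρ : 𝓢(ℝ, ℝ)) : Prop :=
  (∀ x : ℝ, 0 < ρ x) ∧ ∃ K : ℝ, 0 < K ∧ ∀ x : ℝ, x ∉ Icc (-K) K → x * deriv ρ x ≤ 0

/-- The function `v` is a weak derivative of order `n` of `u` on the open set `Ω ⊆ ℝ`,
tested against smooth functions with compact support in `Ω`. -/
def IsWeakDeriv (Ω : Set ℝ) (n : ℕ) (u v : ℝ → ℂ) : Prop :=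
  LocallyIntegrableOn u Ω volume ∧ LocallyIntegrableOn v Ω volume ∧
    ∀ ψ : ℝ → ℝ, ContDiff ℝ ∞ ψ → HasCompactSupport ψ → tsupport ψ ⊆ Ω →
      ∫ x in Ω, ψ x • v x = (-1 : ℂ) ^ n * ∫ x in Ω, iteratedDeriv n ψ x • u x

/-- Weak derivatives are unique almost everywhere. -/
theorem IsWeakDeriv.ae_eq {Ω : Set ℝ} (hΩ : IsOpen Ω) {n : ℕ} {u v w : ℝ → ℂ}
    (hv : IsWeakDeriv Ω n u v) (hw : IsWeakDeriv Ω n u w) :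
    v =ᵐ[volume.restrict Ω] w := by
  have key : ∀ᵐ x ∂(volume : Measure ℝ), x ∈ Ω → (v - w) x = 0 := by
    refine hΩ.ae_eq_zero_of_integral_contDiff_smul_eq_zero (hv.2.1.sub hw.2.1) ?_
    intro ψ h1 h2 h3
    have hint : ∀ z : ℝ → ℂ, LocallyIntegrableOn z Ω volume →
        Integrable (fun x => ψ x • z x) volume := by
      intro z hz
      have hK : IntegrableOn z (tsupport ψ) volume := hz.integrableOn_compact_subset h3 h2
      have hK' : IntegrableOn (fun x => ψ x • z x) (tsupport ψ) volume :=
        hK.continuousOn_smul h1.continuous.continuousOn h2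
      refine (integrableOn_iff_integrable_of_support_subset ?_).1 hK'
      intro x hx
      refine subset_tsupport ψ ?_
      intro h0
      exact hx (by simp [h0])
    have hset : ∀ z : ℝ → ℂ, ∫ x in Ω, ψ x • z x = ∫ x, ψ x • z x := by
      intro z
      refine setIntegral_eq_integral_of_forall_compl_eq_zero ?_
      intro x hx
      have : ψ x = 0 := image_eq_zero_of_notMem_tsupport fun h => hx (h3 h)
      simp [this]
    have e := (hv.2.2 ψ h1 h2 h3).trans (hw.2.2 ψ h1 h2 h3).symm
    rw [hset, hset] at e
    simp only [Pi.sub_apply, smul_sub]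
    rw [integral_sub (hint v hv.2.1) (hint w hw.2.1), e, sub_self]
  rw [Filter.EventuallyEq, ae_restrict_iff' hΩ.measurableSet]
  filter_upwards [key] with x hx hxΩ
  exact sub_eq_zero.1 (hx hxΩ)

/-- The function `u` has a weak derivative of order `n` on `Ω`. -/
def HasWeakDeriv (Ω : Set ℝ) (n : ℕ) (u : ℝ → ℂ) : Prop :=
  ∃ v : ℝ → ℂ, IsWeakDeriv Ω n u v

open Classical in
/-- The weak derivative of order `n` of `u` on `Ω` (determined up to null sets where it exists,
and zero where it does not). -/
def weakDeriv (Ω : Set ℝ) (n : ℕ) (u : ℝ → ℂ) : ℝ → ℂ :=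
  if h : HasWeakDeriv Ω n u then h.choose else 0

/-- The weighted Sobolev space of order `α` on the real line, based on square integrability:
all weak derivatives of order at most `α` exist and are square integrable with weight `ρ`. -/
def weightedSobolev (α : ℕ) (ρ : ℝ → ℝ) : Set (ℝ → ℂ) :=
  {f | ∀ τ ≤ α, HasWeakDeriv univ τ f ∧
    Integrable (fun x => ‖weakDeriv univ τ f x‖ ^ 2 * ρ x) volume}

/-- The norm of the weighted Sobolev space of order `α`. -/
def weightedSobolevNorm (α : ℕ) (ρ : ℝ → ℝ) (f : ℝ → ℂ) : ℝ :=
  Real.sqrt (∑ τ ∈ Finset.range (α + 1), ∫ x, ‖weakDeriv univ τ f x‖ ^ 2 * ρ x)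

/-- The periodic Sobolev space of order `α` on `(0, 2π)`, based on square integrability: all weak
derivatives of order at most `α` on `(0, 2π)` are square integrable, and those of order less than
`α` have the same value at `0` and at `2π`. The point values are those of the representative
that is continuous on `[0, 2π]`. -/
def periodicSobolev (α : ℕ) : Set (ℝ → ℂ) :=
  {g | (∀ τ ≤ α, HasWeakDeriv (Ioo 0 (2 * Real.pi)) τ g ∧
      MemLp (weakDeriv (Ioo 0 (2 * Real.pi)) τ g) 2
        (volume.restrict (Ioo 0 (2 * Real.pi)))) ∧
    ∀ τ < α, ∃ h : ℝ → ℂ, IsWeakDeriv (Ioo 0 (2 * Real.pi)) τ g h ∧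
      ContinuousOn h (Icc 0 (2 * Real.pi)) ∧ h 0 = h (2 * Real.pi)}

/-- The Möbius change of variables `θ ↦ -c cot (θ / 2)` from `(0, 2π)` onto the real line. -/
def mobiusAngle (c θ : ℝ) : ℝ := -c * Real.cot (θ / 2)

/-- The transformed integrand `((f ρ) ∘ φ) φ'`, where `φ = mobiusAngle c`. -/
def mobiusTransform (c : ℝ) (ρ : ℝ → ℝ) (f : ℝ → ℂ) (θ : ℝ) : ℂ :=
  f (mobiusAngle c θ) * (ρ (mobiusAngle c θ) : ℂ) * ((deriv (mobiusAngle c) θ : ℝ) : ℂ)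

end

/-! Write `s` for `mobiusSpeed c`, so that `φ' = s ∘ φ`. Then `g = G₀ ∘ φ` with `G₀ = s ρ f`, and
the derivatives of `g` are `Gₙ ∘ φ` with `Gₙ₊₁ = s Gₙ'`. By Leibniz, `Gₙ` is a sum of terms `w
f⁽ᵏ⁾`, `k ≤ n`, where each `w` is a Schwartz function obtained from `ρ` by differentiations,
multiplications by `s` and sums. As `dθ = dx / s` and `1 / s ≤ 2 / c`, the `L²` bound reduces to `w²
≤ C ρ`.

This is the crux, since `ρ'` need not be bounded by a multiple of `ρ`. What survives is `|w| ≤ C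
ρ^(1 - ε)` for every `ε > 0` (`IsNearlyDominated`). Polynomial factors cost an arbitrarily small
power of `ρ`. So do derivatives: iterating Landau's inequality bounds `|w'|` by a power close to one
of `sup |w|` on a half-line, and monotonicity of the tails of `ρ` turns that supremum into a value
at the endpoint.

The same bounds make `Gₙ` and its weak derivative `Gₙ₊₁ / s` integrable for `n < α`. Hence `Gₙ` has
a continuous representative vanishing at `±∞`, which `φ` carries to the endpoints of `(0, 2π)`. -/

/-! ### Interpolation inequalities on half-lines -/

/-- A Landau inequality on a half-line. -/
theorem abs_deriv_sq_le_of_bound_Ici {F : ℝ → ℝ} (hF : Differentiable ℝ F)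
    (hF' : Differentiable ℝ (deriv F)) {x A B : ℝ} (hA : ∀ y, x ≤ y → |F y| ≤ A)
    (hB : ∀ y, x ≤ y → |deriv (deriv F) y| ≤ B) : |deriv F x| ^ 2 ≤ 8 * A * B := by
  have hA0 : 0 ≤ A := (abs_nonneg _).trans (hA x le_rfl)
  have hB0 : 0 ≤ B := (abs_nonneg _).trans (hB x le_rfl)
  have key : ∀ h : ℝ, 0 < h → |deriv F x| * h ≤ 2 * A + B * h ^ 2 := by
    intro h hh
    obtain ⟨ξ, hξ, e⟩ := exists_deriv_eq_slope F (by linarith : x < x + h)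
      hF.continuous.continuousOn hF.differentiableOn
    have h1 : ‖deriv F ξ - deriv F x‖ ≤ B * ‖ξ - x‖ :=
      (convex_Ici x).norm_image_sub_le_of_norm_deriv_le (fun y _ => hF' y)
        (fun y hy => hB y hy) (mem_Ici.2 le_rfl) (mem_Ici.2 hξ.1.le)
    rw [Real.norm_eq_abs, Real.norm_eq_abs, abs_of_pos (sub_pos.2 hξ.1)] at h1
    have h2 : deriv F ξ * h = F (x + h) - F x := by
      rw [e, add_sub_cancel_left, div_mul_cancel₀ _ hh.ne']
    have h3 : |deriv F ξ| * h ≤ 2 * A := by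
      calc |deriv F ξ| * h = |deriv F ξ * h| := by rw [abs_mul, abs_of_pos hh]
        _ = |F (x + h) - F x| := by rw [h2]
        _ ≤ |F (x + h)| + |F x| := abs_sub _ _
        _ ≤ 2 * A := by linarith [hA (x + h) (by linarith), hA x le_rfl]
    have h4 : |deriv F x| ≤ |deriv F ξ| + B * h := by
      have : |deriv F x| - |deriv F ξ| ≤ |deriv F ξ - deriv F x| := by
        rw [abs_sub_comm]; exact abs_sub_abs_le_abs_sub _ _
      have : B * (ξ - x) ≤ B * h := mul_le_mul_of_nonneg_left (by linarith [hξ.2]) hB0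
      linarith
    nlinarith [mul_le_mul_of_nonneg_right h4 hh.le]
  -- The quadratic `B h² - |F' x| h + 2 A` is nonnegative for every real `h`; its discriminant gives
  -- the claim without optimizing in `h` or separating `B = 0`.
  have := discrim_le_zero (a := B) (b := -|deriv F x|) (c := 2 * A) (by
    intro h
    rcases le_or_gt h 0 with h0 | h0
    · nlinarith [mul_nonneg hB0 (mul_self_nonneg h),
        mul_nonneg (abs_nonneg (deriv F x)) (neg_nonneg.2 h0)]
    · nlinarith [key h h0])
  rw [discrim] at this
  nlinarith

theorem SchwartzMap.exists_abs_deriv_le (F : 𝓢(ℝ, ℝ)) : ∃ C, 0 ≤ C ∧ ∀ x, |deriv F x| ≤ C := by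
  obtain ⟨C, hC, h⟩ := (SchwartzMap.derivCLM ℝ ℝ F).decay 0 0
  exact ⟨C, hC.le, fun x => by simpa using h x⟩

theorem SchwartzMap.differentiable_deriv (F : 𝓢(ℝ, ℝ)) : Differentiable ℝ (deriv F) :=
  (SchwartzMap.derivCLM ℝ ℝ F).differentiable

/-- Interpolation on a half-line: the derivative of a Schwartz function is controlled by any power
less than one of a bound for the function. -/
theorem SchwartzMap.exists_abs_deriv_pow_le_of_bound_Ici (k : ℕ) :
    ∀ F : 𝓢(ℝ, ℝ), ∃ C, 0 ≤ C ∧ ∀ x A, (∀ y, x ≤ y → |F y| ≤ A) →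
      |deriv F x| ^ (k + 1) ≤ C * A ^ k := by
  induction k with
  | zero =>
    intro F
    obtain ⟨C, hC, h⟩ := F.exists_abs_deriv_le
    exact ⟨C, hC, fun x A _ => by simpa using h x⟩
  | succ k ih =>
    intro F
    obtain ⟨C, hC, h⟩ := ih (SchwartzMap.derivCLM ℝ ℝ F)
    obtain ⟨D, hD, hD'⟩ := F.exists_abs_deriv_le
    refine ⟨8 ^ (k + 1) * C, by positivity, fun x A hA => ?_⟩
    have hA0 : 0 ≤ A := (abs_nonneg _).trans (hA x le_rfl)
    set S : Set ℝ := (fun y => |deriv F y|) '' Ici x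
    have hbdd : BddAbove S := ⟨D, by rintro _ ⟨y, _, rfl⟩; exact hD' y⟩
    have hne : S.Nonempty := ⟨_, x, mem_Ici.2 le_rfl, rfl⟩
    set B := sSup S
    have hB : ∀ y, x ≤ y → |deriv F y| ≤ B := fun y hy => le_csSup hbdd ⟨y, hy, rfl⟩
    have hB0 : 0 ≤ B := (abs_nonneg _).trans (hB x le_rfl)
    -- The induction hypothesis for `F'`, bounded by `B` on the half-line, bounds `|F''|` there by
    -- this root; Landau then yields `B² ≤ 8 A r`.
    obtain ⟨r, hr0, hr⟩ : ∃ r : ℝ, 0 ≤ r ∧ r ^ (k + 1) = C * B ^ k :=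
      ⟨(C * B ^ k) ^ (((k + 1 : ℕ) : ℝ)⁻¹), by positivity,
        Real.rpow_inv_natCast_pow (by positivity) (Nat.succ_ne_zero k)⟩
    have hr2 : ∀ y, x ≤ y → |deriv (deriv F) y| ≤ r := by
      intro y hy
      refine le_of_pow_le_pow_left₀ (Nat.succ_ne_zero k) hr0 ?_
      rw [hr]
      exact h y B fun z hz => hB z (hy.trans hz)
    have h1 : B ≤ Real.sqrt (8 * A * r) := by
      refine csSup_le hne ?_
      rintro _ ⟨y, hy, rfl⟩
      refine Real.le_sqrt_of_sq_le ?_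
      exact abs_deriv_sq_le_of_bound_Ici F.differentiable F.differentiable_deriv
        (fun z hz => hA z ((mem_Ici.1 hy).trans hz)) (fun z hz => hr2 z ((mem_Ici.1 hy).trans hz))
    have h2 : B ^ 2 ≤ 8 * A * r := by
      have := pow_le_pow_left₀ hB0 h1 2
      rwa [Real.sq_sqrt (by positivity)] at this
    -- This is the `(k + 1)`st power of `B² ≤ 8 A r`; cancelling `B ^ k` closes the induction.
    have h3 : B ^ k * B ^ (k + 2) ≤ B ^ k * (8 ^ (k + 1) * C * A ^ (k + 1)) := by
      calc B ^ k * B ^ (k + 2) = (B ^ 2) ^ (k + 1) := by ring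
        _ ≤ (8 * A * r) ^ (k + 1) := pow_le_pow_left₀ (by positivity) h2 _
        _ = 8 ^ (k + 1) * A ^ (k + 1) * (C * B ^ k) := by rw [mul_pow, mul_pow, hr]
        _ = _ := by ring
    refine (pow_le_pow_left₀ (abs_nonneg _) (hB x le_rfl) _).trans ?_
    rcases hB0.eq_or_lt with h0 | h0
    · rw [← h0]; simp; positivity
    · exact le_of_mul_le_mul_left h3 (by positivity)

theorem SchwartzMap.exists_abs_deriv_pow_le_of_bound_Iic (k : ℕ) (F : 𝓢(ℝ, ℝ)) :
    ∃ C, 0 ≤ C ∧ ∀ x A, (∀ y, y ≤ x → |F y| ≤ A) → |deriv F x| ^ (k + 1) ≤ C * A ^ k := by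
  obtain ⟨C, hC, h⟩ := SchwartzMap.exists_abs_deriv_pow_le_of_bound_Ici k
    (SchwartzMap.compCLMOfContinuousLinearEquiv ℝ (ContinuousLinearEquiv.neg ℝ) F)
  refine ⟨C, hC, fun x A hA => ?_⟩
  have := h (-x) A (fun y hy => by simpa using hA (-y) (by linarith))
  have e : ⇑(SchwartzMap.compCLMOfContinuousLinearEquiv ℝ (ContinuousLinearEquiv.neg ℝ) F)
      = fun y => F (-y) := by ext y; simp
  rw [e, deriv_comp_neg] at this
  simpa using this

/-! ### Functions dominated by almost the first power of the weight -/

/-- The Schwartz function `w` is bounded by a multiple of every power less than one of `ρ`. -/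
def IsNearlyDominated (ρ w : 𝓢(ℝ, ℝ)) : Prop :=
  ∀ k : ℕ, ∃ C, 0 ≤ C ∧ ∀ x, |w x| ^ (k + 1) ≤ C * ρ x ^ k

/-- Since `C ≤ (1 + C) ^ n`, the factor `1 + C` can stand in for the `n`th root of `C`. -/
theorem le_mul_of_pow_le_mul_pow {n : ℕ} (hn : n ≠ 0) {C X Y : ℝ} (hC : 0 ≤ C)
    (hY : 0 ≤ Y) (h : X ^ n ≤ C * Y ^ n) : X ≤ (1 + C) * Y := by
  refine le_of_pow_le_pow_left₀ hn (by positivity) (h.trans ?_)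
  rw [mul_pow]
  refine mul_le_mul_of_nonneg_right ?_ (by positivity)
  have : 1 + C ≤ (1 + C) ^ n := le_self_pow₀ (by linarith) hn
  linarith

theorem SchwartzMap.exists_abs_le (F : 𝓢(ℝ, ℝ)) : ∃ C, 0 ≤ C ∧ ∀ x, |F x| ≤ C := by
  obtain ⟨C, hC, h⟩ := F.decay 0 0
  exact ⟨C, hC.le, fun x => by simpa using h x⟩

theorem IsNearlyDominated.self {ρ : 𝓢(ℝ, ℝ)} (hρ : ∀ x, 0 < ρ x) : IsNearlyDominated ρ ρ := by
  intro k
  obtain ⟨C, hC, h⟩ := ρ.exists_abs_le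
  refine ⟨C, hC, fun x => ?_⟩
  rw [pow_succ', abs_of_pos (hρ x)]
  exact mul_le_mul_of_nonneg_right ((le_abs_self _).trans (h x)) (pow_nonneg (hρ x).le _)

theorem IsNearlyDominated.zero {ρ : 𝓢(ℝ, ℝ)} : IsNearlyDominated ρ 0 :=
  fun k => ⟨0, le_rfl, fun x => by simp⟩

theorem IsNearlyDominated.add {ρ v w : 𝓢(ℝ, ℝ)} (hv : IsNearlyDominated ρ v)
    (hw : IsNearlyDominated ρ w) : IsNearlyDominated ρ (v + w) := by
  intro k
  obtain ⟨C, hC, h⟩ := hv k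
  obtain ⟨D, hD, h'⟩ := hw k
  refine ⟨2 ^ k * (C + D), by positivity, fun x => ?_⟩
  calc |(v + w) x| ^ (k + 1) ≤ (|v x| + |w x|) ^ (k + 1) :=
        pow_le_pow_left₀ (abs_nonneg _) (abs_add_le _ _) _
    _ ≤ 2 ^ k * (|v x| ^ (k + 1) + |w x| ^ (k + 1)) := by
        simpa using add_pow_le (abs_nonneg (v x)) (abs_nonneg (w x)) (k + 1)
    _ ≤ 2 ^ k * (C * ρ x ^ k + D * ρ x ^ k) := by gcongr; exacts [h x, h' x]
    _ = _ := by ring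

/-- Domination with exponent `2 * k + 1`, compared with the square of the target, leaves one spare
factor `ρ`, and `p ^ (2 * k + 2) * ρ` is bounded because `ρ` is Schwartz. -/
theorem IsNearlyDominated.smulLeft {ρ w : 𝓢(ℝ, ℝ)} (hρ : ∀ x, 0 < ρ x)
    (hw : IsNearlyDominated ρ w) {p : ℝ → ℝ} (hp : p.HasTemperateGrowth) :
    IsNearlyDominated ρ (SchwartzMap.smulLeftCLM ℝ p w) := by
  intro k
  obtain ⟨C, hC, h⟩ := hw (2 * k + 1)
  obtain ⟨D, hD, h'⟩ := (SchwartzMap.smulLeftCLM ℝ (p ^ (2 * k + 2)) ρ).exists_abs_le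
  refine ⟨1 + C * D, by positivity, fun x => ?_⟩
  refine le_mul_of_pow_le_mul_pow two_ne_zero (by positivity) (pow_nonneg (hρ x).le _) ?_
  have h1 := h' x
  rw [SchwartzMap.smulLeftCLM_apply_apply (hp.pow _)] at h1
  rw [SchwartzMap.smulLeftCLM_apply_apply hp]
  have h2 : |p x| ^ (2 * k + 2) * ρ x ≤ D := by
    simpa [abs_mul, abs_pow, abs_of_pos (hρ x)] using h1
  have h3 := h x
  calc (|p x • w x| ^ (k + 1)) ^ 2 = |p x| ^ (2 * k + 2) * |w x| ^ (2 * k + 1 + 1) := by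
        rw [smul_eq_mul, abs_mul]; ring
    _ ≤ |p x| ^ (2 * k + 2) * (C * ρ x ^ (2 * k + 1)) := by gcongr
    _ = (|p x| ^ (2 * k + 2) * ρ x) * (C * ρ x ^ (2 * k)) := by ring
    _ ≤ D * (C * ρ x ^ (2 * k)) := by
        have := (hρ x).le
        gcongr
    _ = _ := by ring

theorem IsNearlyDominated.sq_le {ρ w : 𝓢(ℝ, ℝ)} (hw : IsNearlyDominated ρ w) :
    ∃ C, 0 ≤ C ∧ ∀ x, w x ^ 2 ≤ C * ρ x := by
  obtain ⟨C, hC, h⟩ := hw 1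
  exact ⟨C, hC, fun x => by simpa using h x⟩

theorem IsMonotonicSchwartzWeight.exists_antitoneOn_monotoneOn {ρ : 𝓢(ℝ, ℝ)}
    (hρ : IsMonotonicSchwartzWeight ρ) :
    ∃ K, 0 < K ∧ AntitoneOn ρ (Ici K) ∧ MonotoneOn ρ (Iic (-K)) := by
  obtain ⟨_, K, hK, h⟩ := hρ
  refine ⟨K, hK, ?_, ?_⟩
  · refine antitoneOn_of_deriv_nonpos (convex_Ici K) ρ.continuous.continuousOn
      ρ.differentiable.differentiableOn fun x hx => ?_
    rw [interior_Ici, mem_Ioi] at hx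
    have := h x fun hx' => absurd hx'.2 (not_le.2 hx)
    nlinarith
  · refine monotoneOn_of_deriv_nonneg (convex_Iic (-K)) ρ.continuous.continuousOn
      ρ.differentiable.differentiableOn fun x hx => ?_
    rw [interior_Iic, mem_Iio] at hx
    have := h x fun hx' => absurd hx'.1 (not_le.2 hx)
    nlinarith

/-- On a tail, `ρ` is largest at the endpoint `x` of the outward half-line, so `|w|` is bounded
there by a power of `ρ x`, and interpolation bounds `w' x`. On `[-K, K]` compactness and positivity
of `ρ` suffice. -/
theorem IsNearlyDominated.deriv {ρ w : 𝓢(ℝ, ℝ)} (hρ : IsMonotonicSchwartzWeight ρ)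
    (hw : IsNearlyDominated ρ w) : IsNearlyDominated ρ (SchwartzMap.derivCLM ℝ ℝ w) := by
  intro k
  have hpos := hρ.1
  obtain ⟨K, hK, hanti, hmono⟩ := hρ.exists_antitoneOn_monotoneOn
  obtain ⟨C, hC, h⟩ := hw (2 * k + 1)
  obtain ⟨R, hR, hR'⟩ := ρ.exists_abs_le
  obtain ⟨D, hD, hD'⟩ := SchwartzMap.exists_abs_deriv_pow_le_of_bound_Ici (2 * k + 1) w
  obtain ⟨E, hE, hE'⟩ := w.exists_abs_deriv_pow_le_of_bound_Iic (2 * k + 1)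
  obtain ⟨M, hM⟩ := (isCompact_Icc (a := -K) (b := K)).exists_bound_of_continuousOn
    (f := fun x => |_root_.deriv w x| ^ (k + 1) / ρ x ^ k) (by
      refine ContinuousOn.div ?_ (by fun_prop) fun x _ => (pow_pos (hpos x) k).ne'
      exact ((w.differentiable_deriv.continuous.abs).pow _).continuousOn)
  have hM0 : 0 ≤ M := (norm_nonneg _).trans (hM 0 ⟨by linarith, hK.le⟩)
  have root : ∀ x, ∃ A, 0 ≤ A ∧ A ^ (2 * k + 2) = C * ρ x ^ (2 * k + 1) := fun x =>
    have := (hpos x).le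
    ⟨(C * ρ x ^ (2 * k + 1)) ^ (((2 * k + 2 : ℕ) : ℝ)⁻¹), by positivity,
        Real.rpow_inv_natCast_pow (by positivity) (Nat.succ_ne_zero _)⟩
  -- Domination and interpolation each cost a factor `(2k+1)/(2k+2)` in the exponent. Since `(2k+1)²
  -- = 4k(k+1) + 1`, one power of `ρ` is left over, absorbed by its bound `R`.
  have tail : ∀ (L : ℝ) (x A : ℝ), 0 ≤ L → 0 ≤ A → A ^ (2 * k + 2) = C * ρ x ^ (2 * k + 1) →
      |_root_.deriv w x| ^ (2 * k + 1 + 1) ≤ L * A ^ (2 * k + 1) →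
      |_root_.deriv w x| ^ (k + 1) ≤ (1 + L ^ (2 * k + 2) * C ^ (2 * k + 1) * R) * ρ x ^ k := by
    intro L x A hL hA hAx hx
    have hρx := (hpos x).le
    refine le_mul_of_pow_le_mul_pow (n := 4 * (k + 1)) (by omega) (by positivity)
      (pow_nonneg hρx _) ?_
    calc (|_root_.deriv w x| ^ (k + 1)) ^ (4 * (k + 1))
        = (|_root_.deriv w x| ^ (2 * k + 1 + 1)) ^ (2 * k + 2) := by
          rw [← pow_mul, ← pow_mul]; congr 1; ring
      _ ≤ (L * A ^ (2 * k + 1)) ^ (2 * k + 2) := pow_le_pow_left₀ (by positivity) hx _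
      _ = L ^ (2 * k + 2) * (A ^ (2 * k + 2)) ^ (2 * k + 1) := by
          rw [mul_pow, ← pow_mul, ← pow_mul, mul_comm (2 * k + 1)]
      _ = L ^ (2 * k + 2) * C ^ (2 * k + 1) * (ρ x * (ρ x ^ k) ^ (4 * (k + 1))) := by
          rw [hAx]; ring
      _ ≤ L ^ (2 * k + 2) * C ^ (2 * k + 1) * (R * (ρ x ^ k) ^ (4 * (k + 1))) := by
          gcongr; exact (le_abs_self _).trans (hR' x)
      _ = _ := by ring
  have bound : ∀ x y A, 0 ≤ A → A ^ (2 * k + 2) = C * ρ x ^ (2 * k + 1) → ρ y ≤ ρ x →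
      |w y| ≤ A := by
    intro x y A hA hAx hxy
    refine le_of_pow_le_pow_left₀ (n := 2 * k + 2) (by omega) hA ?_
    rw [hAx]
    refine (h y).trans ?_
    gcongr
    exact (hpos y).le
  refine ⟨M + (1 + D ^ (2 * k + 2) * C ^ (2 * k + 1) * R) +
    (1 + E ^ (2 * k + 2) * C ^ (2 * k + 1) * R), by positivity, fun x => ?_⟩
  rw [SchwartzMap.derivCLM_apply]
  have hρk : 0 < ρ x ^ k := pow_pos (hpos x) k
  have hD1 : 0 ≤ (1 + D ^ (2 * k + 2) * C ^ (2 * k + 1) * R) * ρ x ^ k := by positivity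
  have hE1 : 0 ≤ (1 + E ^ (2 * k + 2) * C ^ (2 * k + 1) * R) * ρ x ^ k := by positivity
  have hM1 : 0 ≤ M * ρ x ^ k := by positivity
  rw [add_mul, add_mul]
  rcases lt_or_ge x (-K) with hx | hx
  · obtain ⟨A, hA, hAx⟩ := root x
    have := tail E x A hE hA hAx (hE' x A fun y hy => bound x y A hA hAx
      (hmono (mem_Iic.2 (hy.trans hx.le)) (mem_Iic.2 hx.le) hy))
    linarith
  rcases lt_or_ge K x with hx' | hx'
  · obtain ⟨A, hA, hAx⟩ := root x
    have := tail D x A hD hA hAx (hD' x A fun y hy => bound x y A hA hAx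
      (hanti (mem_Ici.2 hx'.le) (mem_Ici.2 (hx'.le.trans hy)) hy))
    linarith
  · have := hM x ⟨hx, hx'⟩
    rw [Real.norm_of_nonneg (by positivity), div_le_iff₀ hρk] at this
    linarith

/-! ### Weak derivatives on the line -/

/-- A test function with vanishing integral is the derivative of a test function. -/
theorem exists_deriv_eq_of_integral_eq_zero {ψ : ℝ → ℝ} (hψ : ContDiff ℝ ∞ ψ)
    (hc : HasCompactSupport ψ) (h0 : ∫ x, ψ x = 0) :
    ∃ Ψ : ℝ → ℝ, ContDiff ℝ ∞ Ψ ∧ HasCompactSupport Ψ ∧ deriv Ψ = ψ := by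
  obtain ⟨R, -, hR⟩ := hc.isCompact.isBounded.subset_closedBall_lt 0 0
  have hz : ∀ x, x ∉ Icc (-R) R → ψ x = 0 := by
    intro x hx
    refine image_eq_zero_of_notMem_tsupport fun h => hx ?_
    have := hR h
    rwa [Real.closedBall_eq_Icc, zero_sub, zero_add] at this
  have hint : ∀ a b, IntervalIntegrable ψ volume a b := fun a b =>
    hψ.continuous.intervalIntegrable a b
  have hd : ∀ x, HasDerivAt (fun x => ∫ t in (-R - 1)..x, ψ t) (ψ x) x := fun x =>
    intervalIntegral.integral_hasDerivAt_right (hint _ _)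
      (hψ.continuous.stronglyMeasurableAtFilter _ _) hψ.continuous.continuousAt
  have hde : deriv (fun x => ∫ t in (-R - 1)..x, ψ t) = ψ := funext fun x => (hd x).deriv
  -- Starting strictly to the left of `-R` keeps the whole support inside the half-open interval of
  -- integration.
  refine ⟨fun x => ∫ t in (-R - 1)..x, ψ t, ?_, ?_, hde⟩
  · exact contDiff_infty_iff_deriv.2 ⟨fun x => (hd x).differentiableAt, by rw [hde]; exact hψ⟩
  · refine HasCompactSupport.intro (isCompact_Icc (a := -R - 1) (b := R)) fun x hx => ?_
    rcases lt_or_ge x (-R - 1) with h | h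
    · refine intervalIntegral.integral_zero_ae (ae_of_all _ fun t ht => hz t fun ht' => ?_)
      rw [uIoc_of_ge h.le] at ht
      linarith [ht.2, ht'.1]
    · have hx' : R < x := by by_contra h'; exact hx ⟨h, not_lt.1 h'⟩
      rw [intervalIntegral.integral_eq_integral_of_support_subset, h0]
      intro t ht
      by_contra h'
      refine ht (hz t fun ht' => h' ⟨by linarith [ht'.1], by linarith [ht'.2]⟩)

theorem integrable_smul_of_hasCompactSupport {ψ : ℝ → ℝ} (hψ : Continuous ψ)
    (hc : HasCompactSupport ψ) {u : ℝ → ℂ} (hu : LocallyIntegrable u volume) :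
    Integrable (fun x => ψ x • u x) :=
  hu.integrable_smul_left_of_hasCompactSupport hψ hc

/-- A locally integrable function with vanishing weak derivative is constant. -/
theorem exists_ae_eq_const_of_integral_deriv_smul_eq_zero {d : ℝ → ℂ}
    (hd : LocallyIntegrable d volume)
    (h : ∀ ψ : ℝ → ℝ, ContDiff ℝ ∞ ψ → HasCompactSupport ψ → ∫ x, deriv ψ x • d x = 0) :
    ∃ c : ℂ, d =ᵐ[volume] fun _ => c := by
  -- For every test function `ψ`, `ψ - (∫ ψ) η` has integral zero, hence is a derivative and is
  -- annihilated by `d`; this identifies the constant as `∫ η d`.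
  let b : ContDiffBump (0 : ℝ) := ⟨1, 2, one_pos, one_lt_two⟩
  set η : ℝ → ℝ := b.normed volume
  have hη1 : ContDiff ℝ ∞ η := b.contDiff_normed
  have hη2 : HasCompactSupport η := b.hasCompactSupport_normed
  have hη3 : ∫ x, η x = 1 := b.integral_normed
  refine ⟨∫ x, η x • d x, ?_⟩
  have key : ∀ᵐ x ∂(volume : Measure ℝ), d x - (∫ x, η x • d x) = 0 := by
    refine ae_eq_zero_of_integral_contDiff_smul_eq_zero
      (hd.sub (locallyIntegrable_const _)) fun ψ h1 h2 => ?_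
    have hint := h1.continuous.integrable_of_hasCompactSupport (μ := volume) h2
    have hηint := hη1.continuous.integrable_of_hasCompactSupport (μ := volume) hη2
    obtain ⟨Ψ, k1, k2, k3⟩ := exists_deriv_eq_of_integral_eq_zero
      (ψ := fun x => ψ x - (∫ y, ψ y) * η x) (h1.sub (contDiff_const.mul hη1))
      (h2.sub hη2.mul_left)
      (by rw [integral_sub hint (hηint.const_mul _), integral_const_mul, hη3, mul_one, sub_self])
    have e := h Ψ k1 k2
    simp only [k3, sub_smul, mul_smul] at e
    have hηd : Integrable fun x => (∫ y, ψ y) • η x • d x :=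
      (integrable_smul_of_hasCompactSupport hη1.continuous hη2 hd).smul (∫ y, ψ y)
    rw [integral_sub (integrable_smul_of_hasCompactSupport h1.continuous h2 hd) hηd,
      integral_smul] at e
    simp only [smul_sub]
    rw [integral_sub (integrable_smul_of_hasCompactSupport h1.continuous h2 hd)
      (hint.smul_const _), integral_smul_const, e]
  filter_upwards [key] with x hx using sub_eq_zero.1 hx

/-- Fubini on `{t ≤ x}`: integrating `ψ'` over `[t, ∞)` gives `-ψ t`. -/
theorem integral_deriv_smul_integral_Iic {v : ℝ → ℂ} (hv : Integrable v) {ψ : ℝ → ℝ}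
    (h1 : ContDiff ℝ ∞ ψ) (h2 : HasCompactSupport ψ) :
    ∫ x, deriv ψ x • ∫ t in Iic x, v t = -∫ x, ψ x • v x := by
  have hd : Continuous (deriv ψ) := h1.continuous_deriv (by simp)
  have hdint : Integrable (deriv ψ) := hd.integrable_of_hasCompactSupport h2.deriv
  have hprod : Integrable (fun z : ℝ × ℝ => deriv ψ z.1 • v z.2) (volume.prod volume) :=
    hdint.smul_prod hv
  have hms : MeasurableSet {z : ℝ × ℝ | z.2 ≤ z.1} := measurableSet_le measurable_snd measurable_fst
  have hind := hprod.indicator hms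
  have e1 : ∀ x, deriv ψ x • ∫ t in Iic x, v t =
      ∫ t, {z : ℝ × ℝ | z.2 ≤ z.1}.indicator (fun z => deriv ψ z.1 • v z.2) (x, t) := by
    intro x
    rw [← integral_smul, ← integral_indicator measurableSet_Iic]
    rfl
  have e2 : ∀ t, ∫ x, {z : ℝ × ℝ | z.2 ≤ z.1}.indicator (fun z => deriv ψ z.1 • v z.2) (x, t) =
      -(ψ t • v t) := by
    intro t
    have : ∀ x, {z : ℝ × ℝ | z.2 ≤ z.1}.indicator (fun z => deriv ψ z.1 • v z.2) (x, t) =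
      (Ici t).indicator (fun x => deriv ψ x • v t) x := fun x => rfl
    simp only [this]
    rw [integral_indicator measurableSet_Ici, integral_smul_const, integral_Ici_eq_integral_Ioi,
      h2.integral_Ioi_deriv_eq (h1.of_le (by simp)), neg_smul]
  simp only [e1]
  rw [integral_integral_swap (f := fun x t =>
    {z : ℝ × ℝ | z.2 ≤ z.1}.indicator (fun z => deriv ψ z.1 • v z.2) (x, t)) hind]
  simp only [e2]
  exact integral_neg _

/-- An integrable function on the line with integrable weak derivative has a continuous
representative that vanishes at infinity. -/
theorem exists_continuous_ae_eq_tendsto_zero {u v : ℝ → ℂ} (hu : Integrable u) (hv : Integrable v)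
    (h : ∀ ψ : ℝ → ℝ, ContDiff ℝ ∞ ψ → HasCompactSupport ψ →
      ∫ x, ψ x • v x = -∫ x, deriv ψ x • u x) :
    ∃ H : ℝ → ℂ, Continuous H ∧ H =ᵐ[volume] u ∧ Tendsto H atTop (𝓝 0) ∧
      Tendsto H atBot (𝓝 0) := by
  set P : ℝ → ℂ := fun x => ∫ t in Iic x, v t
  have hPe : P = fun x => (∫ t in Iic 0, v t) + ∫ t in (0 : ℝ)..x, v t := by
    ext x
    rw [← intervalIntegral.integral_Iic_sub_Iic hv.integrableOn hv.integrableOn]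
    ring
  have hPc : Continuous P := by
    rw [hPe]
    exact continuous_const.add (intervalIntegral.continuous_primitive
      (fun a b => hv.intervalIntegrable) 0)
  have hPtop : Tendsto P atTop (𝓝 ((∫ t in Iic 0, v t) + ∫ t in Ioi 0, v t)) := by
    rw [hPe]
    exact (intervalIntegral_tendsto_integral_Ioi 0 hv.integrableOn tendsto_id).const_add _
  have hPbot : Tendsto P atBot (𝓝 0) := by
    have := (intervalIntegral_tendsto_integral_Iic 0 (hv.integrableOn (s := Iic 0))
      tendsto_id).const_sub (∫ t in Iic 0, v t)
    rw [sub_self] at this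
    refine this.congr fun x => ?_
    simp only [hPe, id]
    rw [intervalIntegral.integral_symm 0 x]
    ring
  obtain ⟨c, hc⟩ := exists_ae_eq_const_of_integral_deriv_smul_eq_zero (d := fun x => u x - P x)
    (hu.locallyIntegrable.sub hPc.locallyIntegrable) (by
      intro ψ h1 h2
      have hd : Continuous (deriv ψ) := h1.continuous_deriv (by simp)
      simp only [smul_sub]
      rw [integral_sub
        (integrable_smul_of_hasCompactSupport hd h2.deriv hu.locallyIntegrable)
        (integrable_smul_of_hasCompactSupport hd h2.deriv hPc.locallyIntegrable),
        integral_deriv_smul_integral_Iic hv h1 h2, h ψ h1 h2]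
      ring)
  have hHu : (fun x => P x + c) =ᵐ[volume] u := by
    filter_upwards [hc] with x hx
    rw [← hx]; ring
  have hHint : Integrable (fun x => P x + c) := hu.congr hHu.symm
  -- An integrable function with a limit along a half-line of infinite measure has limit zero; the
  -- same argument at `+∞` kills the total integral of `v`.
  have hc0 : c = 0 := by
    refine IntegrableAtFilter.eq_zero_of_tendsto (l := atBot) (μ := volume)
      (hHint.integrableAtFilter _) (fun s hs => ?_) (by simpa using hPbot.add_const c)
    obtain ⟨b, hb⟩ := mem_atBot_sets.1 hs
    rw [← top_le_iff, ← Real.volume_Iic (a := b)]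
    exact measure_mono hb
  simp only [hc0, add_zero] at hHu hHint
  have hL := IntegrableAtFilter.eq_zero_of_tendsto (l := atTop) (μ := volume)
      (hHint.integrableAtFilter _) (fun s hs => by
        obtain ⟨b, hb⟩ := mem_atTop_sets.1 hs
        rw [← top_le_iff, ← Real.volume_Ici (a := b)]
        exact measure_mono hb) hPtop
  exact ⟨P, hPc, hHu, hL ▸ hPtop, hPbot⟩

/-! ### The Möbius change of variables -/

/-- The derivative of `mobiusAngle c`, as a function of the value of `mobiusAngle c`. -/
noncomputable def mobiusSpeed (c x : ℝ) : ℝ := (c ^ 2 + x ^ 2) / (2 * c)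

/-- The inverse of `mobiusAngle c`. -/
noncomputable def mobiusInv (c x : ℝ) : ℝ := Real.pi + 2 * Real.arctan (x / c)

section Mobius

variable {c : ℝ}

theorem half_le_mobiusSpeed (hc : 0 < c) (x : ℝ) : c / 2 ≤ mobiusSpeed c x := by
  rw [mobiusSpeed, div_le_div_iff₀ two_pos (by positivity)]
  nlinarith [sq_nonneg x]

theorem mobiusSpeed_pos (hc : 0 < c) (x : ℝ) : 0 < mobiusSpeed c x :=
  (half_pos hc).trans_le (half_le_mobiusSpeed hc x)

theorem inv_mobiusSpeed_le (hc : 0 < c) (x : ℝ) : (mobiusSpeed c x)⁻¹ ≤ 2 / c := by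
  rw [← inv_div]
  exact inv_anti₀ (half_pos hc) (half_le_mobiusSpeed hc x)

theorem continuous_mobiusSpeed : Continuous (mobiusSpeed c) := by
  unfold mobiusSpeed; fun_prop

theorem hasTemperateGrowth_mobiusSpeed : (mobiusSpeed c).HasTemperateGrowth := by
  have : mobiusSpeed c = (fun _ => (2 * c)⁻¹) * ((fun _ => c ^ 2) + (fun x => x) ^ 2) := by
    ext x; simp [mobiusSpeed]; ring
  rw [this]
  exact (Function.HasTemperateGrowth.const _).mul
    ((Function.HasTemperateGrowth.const _).add (Function.HasTemperateGrowth.id'.pow 2))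

theorem mobiusAngle_eq_tan (c θ : ℝ) :
    mobiusAngle c θ = c * Real.tan (θ / 2 - Real.pi / 2) := by
  rw [mobiusAngle, Real.tan_eq_sin_div_cos, Real.sin_sub_pi_div_two, Real.cos_sub_pi_div_two,
    Real.cot_eq_cos_div_sin]
  ring

theorem hasDerivAt_mobiusInv (hc : 0 < c) (x : ℝ) :
    HasDerivAt (mobiusInv c) (mobiusSpeed c x)⁻¹ x := by
  have h := (((hasDerivAt_id x).div_const c).arctan.const_mul 2).const_add Real.pi
  refine h.congr_deriv ?_
  simp only [mobiusSpeed, id]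
  field_simp

theorem contDiff_mobiusInv : ContDiff ℝ ∞ (mobiusInv c) := by
  unfold mobiusInv
  exact contDiff_const.add (contDiff_const.mul
    (Real.contDiff_arctan.comp (contDiff_id.div_const c)))

theorem mobiusInv_mem (x : ℝ) : mobiusInv c x ∈ Ioo 0 (2 * Real.pi) := by
  have h1 := Real.neg_pi_div_two_lt_arctan (x / c)
  have h2 := Real.arctan_lt_pi_div_two (x / c)
  constructor <;> unfold mobiusInv <;> linarith

theorem mobiusAngle_mobiusInv (hc : 0 < c) (x : ℝ) : mobiusAngle c (mobiusInv c x) = x := by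
  rw [mobiusAngle_eq_tan, mobiusInv]
  have : (Real.pi + 2 * Real.arctan (x / c)) / 2 - Real.pi / 2 = Real.arctan (x / c) := by ring
  rw [this, Real.tan_arctan]
  field_simp

theorem mobiusInv_mobiusAngle (hc : 0 < c) {θ : ℝ} (hθ : θ ∈ Ioo 0 (2 * Real.pi)) :
    mobiusInv c (mobiusAngle c θ) = θ := by
  rw [mobiusAngle_eq_tan, mobiusInv, mul_div_cancel_left₀ _ hc.ne',
    Real.arctan_tan (by linarith [hθ.1]) (by linarith [hθ.2])]
  ring

theorem image_mobiusInv (hc : 0 < c) : mobiusInv c '' univ = Ioo 0 (2 * Real.pi) := by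
  ext θ
  constructor
  · rintro ⟨x, -, rfl⟩
    exact mobiusInv_mem x
  · exact fun hθ => ⟨mobiusAngle c θ, mem_univ _, mobiusInv_mobiusAngle hc hθ⟩

theorem injective_mobiusInv (hc : 0 < c) : Function.Injective (mobiusInv c) :=
  Function.LeftInverse.injective (mobiusAngle_mobiusInv hc)

theorem hasDerivAt_mobiusAngle (hc : 0 < c) {θ : ℝ} (hθ : θ ∈ Ioo 0 (2 * Real.pi)) :
    HasDerivAt (mobiusAngle c) (mobiusSpeed c (mobiusAngle c θ)) θ := by
  have hcos : 0 < Real.cos (θ / 2 - Real.pi / 2) :=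
    Real.cos_pos_of_mem_Ioo ⟨by linarith [hθ.1], by linarith [hθ.2]⟩
  have e : mobiusAngle c = fun θ => c * Real.tan (θ / 2 - Real.pi / 2) :=
    funext (mobiusAngle_eq_tan c)
  rw [e]
  have h := (((Real.hasDerivAt_tan hcos.ne').comp θ
    (((hasDerivAt_id θ).div_const 2).sub_const (Real.pi / 2))).const_mul c)
  refine h.congr_deriv ?_
  simp only [mobiusSpeed, Real.tan_eq_sin_div_cos]
  generalize θ / 2 - Real.pi / 2 = y at hcos ⊢
  have := Real.sin_sq_add_cos_sq y
  field_simp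
  linarith

theorem continuousOn_mobiusAngle (hc : 0 < c) :
    ContinuousOn (mobiusAngle c) (Ioo 0 (2 * Real.pi)) := fun _ hθ =>
  (hasDerivAt_mobiusAngle hc hθ).continuousAt.continuousWithinAt

theorem tendsto_mobiusAngle_nhdsGT_zero (hc : 0 < c) :
    Tendsto (mobiusAngle c) (𝓝[>] 0) atBot := by
  have e : mobiusAngle c = fun θ => c * Real.tan (θ / 2 - Real.pi / 2) :=
    funext (mobiusAngle_eq_tan c)
  rw [e]
  refine Tendsto.const_mul_atBot hc (Real.tendsto_tan_neg_pi_div_two.comp ?_)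
  refine tendsto_nhdsWithin_iff.2 ⟨?_, ?_⟩
  · have : Tendsto (fun θ : ℝ => θ / 2 - Real.pi / 2) (𝓝 0) (𝓝 (0 / 2 - Real.pi / 2)) :=
      Continuous.tendsto (by fun_prop) 0
    rw [zero_div, zero_sub] at this
    exact this.mono_left nhdsWithin_le_nhds
  · filter_upwards [self_mem_nhdsWithin] with θ hθ
    rw [mem_Ioi] at hθ ⊢
    linarith

theorem tendsto_mobiusAngle_nhdsLT_two_pi (hc : 0 < c) :
    Tendsto (mobiusAngle c) (𝓝[<] (2 * Real.pi)) atTop := by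
  have e : mobiusAngle c = fun θ => c * Real.tan (θ / 2 - Real.pi / 2) :=
    funext (mobiusAngle_eq_tan c)
  rw [e]
  refine Tendsto.const_mul_atTop hc (Real.tendsto_tan_pi_div_two.comp ?_)
  refine tendsto_nhdsWithin_iff.2 ⟨?_, ?_⟩
  · have : Tendsto (fun θ : ℝ => θ / 2 - Real.pi / 2) (𝓝 (2 * Real.pi))
        (𝓝 (2 * Real.pi / 2 - Real.pi / 2)) := Continuous.tendsto (by fun_prop) _
    have e2 : 2 * Real.pi / 2 - Real.pi / 2 = Real.pi / 2 := by ring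
    rw [e2] at this
    exact this.mono_left nhdsWithin_le_nhds
  · filter_upwards [self_mem_nhdsWithin] with θ hθ
    rw [mem_Iio] at hθ ⊢
    linarith

theorem setIntegral_Ioo_eq_integral_mobiusInv {E : Type*} [NormedAddCommGroup E] [NormedSpace ℝ E]
    (hc : 0 < c) (F : ℝ → E) :
    ∫ θ in Ioo 0 (2 * Real.pi), F θ = ∫ x, (mobiusSpeed c x)⁻¹ • F (mobiusInv c x) := by
  rw [← image_mobiusInv hc, integral_image_eq_integral_abs_deriv_smul MeasurableSet.univ
    (fun x _ => (hasDerivAt_mobiusInv hc x).hasDerivWithinAt) (injective_mobiusInv hc).injOn,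
    Measure.restrict_univ]
  simp only [abs_of_pos (inv_pos.2 (mobiusSpeed_pos hc _))]

theorem integrableOn_Ioo_iff_integrable_mobiusInv {E : Type*} [NormedAddCommGroup E]
    [NormedSpace ℝ E] (hc : 0 < c) (F : ℝ → E) :
    IntegrableOn F (Ioo 0 (2 * Real.pi)) ↔
      Integrable fun x => (mobiusSpeed c x)⁻¹ • F (mobiusInv c x) := by
  rw [← image_mobiusInv hc, integrableOn_image_iff_integrableOn_abs_deriv_smul MeasurableSet.univ
    (fun x _ => (hasDerivAt_mobiusInv hc x).hasDerivWithinAt) (injective_mobiusInv hc).injOn,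
    integrableOn_univ]
  simp only [abs_of_pos (inv_pos.2 (mobiusSpeed_pos hc _))]

/-- The function is the Jacobian of the inverse map, whose image is an interval of finite length. -/
theorem integrable_inv_mobiusSpeed (hc : 0 < c) : Integrable fun x => (mobiusSpeed c x)⁻¹ := by
  have := (integrableOn_Ioo_iff_integrable_mobiusInv hc (fun _ => (1 : ℝ))).1
    (integrableOn_const (by simp [ENNReal.mul_eq_top]))
  simpa using this

theorem hasCompactSupport_comp_mobiusInv (hc : 0 < c) {ψ : ℝ → ℝ} (h2 : HasCompactSupport ψ)
    (h3 : tsupport ψ ⊆ Ioo 0 (2 * Real.pi)) :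
    HasCompactSupport fun x => ψ (mobiusInv c x) := by
  refine HasCompactSupport.intro
    (h2.isCompact.image_of_continuousOn ((continuousOn_mobiusAngle hc).mono h3)) fun x hx => ?_
  refine image_eq_zero_of_notMem_tsupport fun h => hx ⟨_, h, mobiusAngle_mobiusInv hc x⟩

theorem setIntegral_smul_comp_mobiusAngle (hc : 0 < c) (ψ : ℝ → ℝ) (G : ℝ → ℂ) :
    ∫ θ in Ioo 0 (2 * Real.pi), ψ θ • G (mobiusAngle c θ) =
      ∫ x, ψ (mobiusInv c x) • (mobiusSpeed c x)⁻¹ • G x := by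
  rw [setIntegral_Ioo_eq_integral_mobiusInv hc]
  simp only [mobiusAngle_mobiusInv hc]
  exact integral_congr_ae (ae_of_all _ fun x => smul_comm _ _ _)

/-- Transport of a weak derivative along the Möbius change of variables. -/
theorem setIntegral_smul_comp_mobiusAngle_eq_neg (hc : 0 < c) {U V : ℝ → ℂ}
    (h : ∀ χ : ℝ → ℝ, ContDiff ℝ ∞ χ → HasCompactSupport χ →
      ∫ x, χ x • (mobiusSpeed c x)⁻¹ • V x = -∫ x, deriv χ x • U x)
    {ψ : ℝ → ℝ} (h1 : ContDiff ℝ ∞ ψ) (h2 : HasCompactSupport ψ)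
    (h3 : tsupport ψ ⊆ Ioo 0 (2 * Real.pi)) :
    ∫ θ in Ioo 0 (2 * Real.pi), ψ θ • V (mobiusAngle c θ) =
      -∫ θ in Ioo 0 (2 * Real.pi), deriv ψ θ • U (mobiusAngle c θ) := by
  rw [setIntegral_smul_comp_mobiusAngle hc, setIntegral_smul_comp_mobiusAngle hc,
    h (fun x => ψ (mobiusInv c x)) (h1.comp contDiff_mobiusInv) (hasCompactSupport_comp_mobiusInv hc h2 h3)]
  -- The factor `1 / s` from the chain rule for `ψ ∘ mobiusInv c` is exactly the Jacobian.
  congr 1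
  refine integral_congr_ae (ae_of_all _ fun x => ?_)
  have : deriv (fun x => ψ (mobiusInv c x)) x = deriv ψ (mobiusInv c x) * (mobiusSpeed c x)⁻¹ :=
    (((h1.differentiable (by simp) _).hasDerivAt).comp x (hasDerivAt_mobiusInv hc x)).deriv
  simp only [this, mul_smul]

end Mobius

/-! ### Derivatives of the transform and their bounds -/

/-- The coefficient of the `k`th derivative of `f` in the `n`th derivative of the Möbius
transform of `f`, as a function of the value of `mobiusAngle c`. -/
noncomputable def mobiusCoeff (c : ℝ) (ρ : 𝓢(ℝ, ℝ)) : ℕ → ℕ → 𝓢(ℝ, ℝ)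
  | 0, 0 => SchwartzMap.smulLeftCLM ℝ (mobiusSpeed c) ρ
  | 0, _ + 1 => 0
  | n + 1, 0 => SchwartzMap.smulLeftCLM ℝ (mobiusSpeed c)
      (SchwartzMap.derivCLM ℝ ℝ (mobiusCoeff c ρ n 0))
  | n + 1, k + 1 => SchwartzMap.smulLeftCLM ℝ (mobiusSpeed c)
      (SchwartzMap.derivCLM ℝ ℝ (mobiusCoeff c ρ n (k + 1)) + mobiusCoeff c ρ n k)

/-- The `n`th derivative of the Möbius transform of `f 0`, as a function of the value of
`mobiusAngle c`, where `f k` is the `k`th derivative of `f 0`. -/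
noncomputable def mobiusDeriv (c : ℝ) (ρ : 𝓢(ℝ, ℝ)) (f : ℕ → ℝ → ℂ) (n : ℕ) (x : ℝ) : ℂ :=
  ∑ k ∈ Finset.range (n + 1), mobiusCoeff c ρ n k x • f k x

section

variable {c : ℝ} {ρ : 𝓢(ℝ, ℝ)}

theorem mobiusCoeff_eq_zero {n k : ℕ} (h : n < k) : mobiusCoeff c ρ n k = 0 := by
  induction n generalizing k with
  | zero =>
    obtain ⟨k, rfl⟩ := Nat.exists_eq_succ_of_ne_zero h.ne'
    rfl
  | succ n ih =>
    obtain ⟨k, rfl⟩ := Nat.exists_eq_succ_of_ne_zero (Nat.ne_zero_of_lt h)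
    rw [Nat.succ_eq_add_one, mobiusCoeff, ih (by omega), ih (by omega)]
    simp

theorem isNearlyDominated_mobiusCoeff (hρ : IsMonotonicSchwartzWeight ρ) (n k : ℕ) :
    IsNearlyDominated ρ (mobiusCoeff c ρ n k) := by
  induction n generalizing k with
  | zero =>
    cases k with
    | zero => exact (IsNearlyDominated.self hρ.1).smulLeft hρ.1 hasTemperateGrowth_mobiusSpeed
    | succ k => exact IsNearlyDominated.zero
  | succ n ih =>
    cases k with
    | zero => exact ((ih 0).deriv hρ).smulLeft hρ.1 hasTemperateGrowth_mobiusSpeed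
    | succ k =>
      exact (((ih (k + 1)).deriv hρ).add (ih k)).smulLeft hρ.1 hasTemperateGrowth_mobiusSpeed

theorem mobiusDeriv_zero (f : ℕ → ℝ → ℂ) (x : ℝ) :
    mobiusDeriv c ρ f 0 x = (mobiusSpeed c x * ρ x) • f 0 x := by
  simp [mobiusDeriv, mobiusCoeff,
    SchwartzMap.smulLeftCLM_apply_apply hasTemperateGrowth_mobiusSpeed]

/-- This is `Gₙ₊₁ = s Gₙ'` expanded by Leibniz; the sum can be reindexed because the coefficient of
index `n + 1` in `Gₙ` vanishes. -/
theorem mobiusDeriv_succ (f : ℕ → ℝ → ℂ) (n : ℕ) (x : ℝ) :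
    mobiusDeriv c ρ f (n + 1) x = mobiusSpeed c x • ∑ k ∈ Finset.range (n + 1),
      (mobiusCoeff c ρ n k x • f (k + 1) x + deriv (mobiusCoeff c ρ n k) x • f k x) := by
  have h0 : mobiusCoeff c ρ (n + 1) 0 x =
      mobiusSpeed c x * deriv (mobiusCoeff c ρ n 0) x := by
    simp [mobiusCoeff, SchwartzMap.smulLeftCLM_apply_apply hasTemperateGrowth_mobiusSpeed]
  have h1 : ∀ k, mobiusCoeff c ρ (n + 1) (k + 1) x =
      mobiusSpeed c x * (deriv (mobiusCoeff c ρ n (k + 1)) x + mobiusCoeff c ρ n k x) := by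
    intro k
    simp [mobiusCoeff, SchwartzMap.smulLeftCLM_apply_apply hasTemperateGrowth_mobiusSpeed,
      mul_add]
  have h2 : deriv (mobiusCoeff c ρ n (n + 1)) x = 0 := by
    rw [mobiusCoeff_eq_zero n.lt_succ_self]
    exact deriv_const x (0 : ℝ)
  have h3 : ∑ k ∈ Finset.range (n + 1), deriv (mobiusCoeff c ρ n k) x • f k x =
      ∑ k ∈ Finset.range (n + 1), deriv (mobiusCoeff c ρ n (k + 1)) x • f (k + 1) x +
        deriv (mobiusCoeff c ρ n 0) x • f 0 x := by
    rw [← Finset.sum_range_succ' (fun k => deriv (mobiusCoeff c ρ n k) x • f k x),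
      Finset.sum_range_succ _ (n + 1), h2, zero_smul, add_zero]
  rw [mobiusDeriv, Finset.sum_range_succ', Finset.sum_add_distrib, h3, h0, smul_add, smul_add,
    Finset.smul_sum, Finset.smul_sum, ← add_assoc, ← Finset.sum_add_distrib]
  simp only [h1, smul_smul, mul_add, add_smul]
  congr 1
  exact Finset.sum_congr rfl fun k _ => add_comm _ _

/-- Weak product rule for the derivatives of the Möbius transform. -/
theorem integral_smul_mobiusDeriv_succ (hc : 0 < c) {f : ℕ → ℝ → ℂ} {n : ℕ}
    (hf : ∀ k ≤ n + 1, LocallyIntegrable (f k) volume)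
    (hf' : ∀ k ≤ n, ∀ χ : ℝ → ℝ, ContDiff ℝ ∞ χ → HasCompactSupport χ →
      ∫ x, χ x • f (k + 1) x = -∫ x, deriv χ x • f k x)
    {χ : ℝ → ℝ} (h1 : ContDiff ℝ ∞ χ) (h2 : HasCompactSupport χ) :
    ∫ x, χ x • (mobiusSpeed c x)⁻¹ • mobiusDeriv c ρ f (n + 1) x =
      -∫ x, deriv χ x • mobiusDeriv c ρ f n x := by
  have hd : Continuous (deriv χ) := h1.continuous_deriv (by simp)
  have hW : ∀ k, Continuous (mobiusCoeff c ρ n k) := fun k => (mobiusCoeff c ρ n k).continuous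
  have hW' : ∀ k, Continuous (deriv (mobiusCoeff c ρ n k)) := fun k =>
    (mobiusCoeff c ρ n k).differentiable_deriv.continuous
  have i1 : ∀ k ≤ n, Integrable fun x => (χ x * mobiusCoeff c ρ n k x) • f (k + 1) x :=
    fun k hk => integrable_smul_of_hasCompactSupport (h1.continuous.mul (hW k)) h2.mul_right
      (hf _ (by omega))
  have i2 : ∀ k ≤ n, Integrable fun x => (χ x * deriv (mobiusCoeff c ρ n k) x) • f k x :=
    fun k hk => integrable_smul_of_hasCompactSupport (h1.continuous.mul (hW' k)) h2.mul_right
      (hf _ (by omega))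
  have i3 : ∀ k ≤ n, Integrable fun x => (deriv χ x * mobiusCoeff c ρ n k x) • f k x :=
    fun k hk => integrable_smul_of_hasCompactSupport (hd.mul (hW k)) h2.deriv.mul_right
      (hf _ (by omega))
  have e1 : ∀ x, χ x • (mobiusSpeed c x)⁻¹ • mobiusDeriv c ρ f (n + 1) x =
      ∑ k ∈ Finset.range (n + 1), ((χ x * mobiusCoeff c ρ n k x) • f (k + 1) x +
        (χ x * deriv (mobiusCoeff c ρ n k) x) • f k x) := by
    intro x
    rw [mobiusDeriv_succ, inv_smul_smul₀ (mobiusSpeed_pos hc x).ne', Finset.smul_sum]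
    simp only [smul_add, smul_smul]
  have e2 : ∀ x, deriv χ x • mobiusDeriv c ρ f n x =
      ∑ k ∈ Finset.range (n + 1), (deriv χ x * mobiusCoeff c ρ n k x) • f k x := by
    intro x
    rw [mobiusDeriv, Finset.smul_sum]
    simp only [smul_smul]
  have hle : ∀ k ∈ Finset.range (n + 1), k ≤ n := fun k hk =>
    Nat.lt_succ_iff.1 (Finset.mem_range.1 hk)
  simp only [e1, e2]
  rw [integral_finsetSum _ fun k hk => (i1 k (hle k hk)).fun_add (i2 k (hle k hk)),
    integral_finsetSum _ fun k hk => i3 k (hle k hk), ← Finset.sum_neg_distrib]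
  refine Finset.sum_congr rfl fun k hk => ?_
  have hk := hle k hk
  -- Testing against `χ` times the coefficient produces a term with the derivative of the
  -- coefficient that cancels the second Leibniz term.
  rw [integral_add (i1 k hk) (i2 k hk), hf' k hk (fun x => χ x * mobiusCoeff c ρ n k x)
    (h1.mul ((mobiusCoeff c ρ n k).smooth _)) h2.mul_right]
  have e3 : ∀ x, deriv (fun x => χ x * mobiusCoeff c ρ n k x) x =
      deriv χ x * mobiusCoeff c ρ n k x + χ x * deriv (mobiusCoeff c ρ n k) x := fun x =>
    deriv_fun_mul (h1.differentiable (by simp) x) (mobiusCoeff c ρ n k).differentiableAt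
  simp only [e3, add_smul]
  rw [integral_add (i3 k hk) (i2 k hk)]
  ring

theorem exists_sq_norm_mobiusDeriv_le (hρ : IsMonotonicSchwartzWeight ρ) (c : ℝ) (n : ℕ) :
    ∃ C, 0 ≤ C ∧ ∀ (f : ℕ → ℝ → ℂ) (x : ℝ), ‖mobiusDeriv c ρ f n x‖ ^ 2 ≤
      C * ∑ k ∈ Finset.range (n + 1), ‖f k x‖ ^ 2 * ρ x := by
  choose C hC h using fun k => (isNearlyDominated_mobiusCoeff (c := c) hρ n k).sq_le
  refine ⟨(n + 1 : ℕ) * ∑ k ∈ Finset.range (n + 1), C k, by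
    have := Finset.sum_nonneg fun k (_ : k ∈ Finset.range (n + 1)) => hC k
    positivity, fun f x => ?_⟩
  have h1 : ‖mobiusDeriv c ρ f n x‖ ≤
      ∑ k ∈ Finset.range (n + 1), |mobiusCoeff c ρ n k x| * ‖f k x‖ := by
    refine (norm_sum_le _ _).trans (Finset.sum_le_sum fun k _ => ?_)
    rw [norm_smul, Real.norm_eq_abs]
  calc ‖mobiusDeriv c ρ f n x‖ ^ 2
      ≤ (∑ k ∈ Finset.range (n + 1), |mobiusCoeff c ρ n k x| * ‖f k x‖) ^ 2 :=
        pow_le_pow_left₀ (norm_nonneg _) h1 2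
    _ ≤ (n + 1 : ℕ) * ∑ k ∈ Finset.range (n + 1), (|mobiusCoeff c ρ n k x| * ‖f k x‖) ^ 2 := by
        simpa using sq_sum_le_card_mul_sum_sq (s := Finset.range (n + 1))
          (f := fun k => |mobiusCoeff c ρ n k x| * ‖f k x‖)
    _ ≤ (n + 1 : ℕ) * ∑ k ∈ Finset.range (n + 1),
          (∑ j ∈ Finset.range (n + 1), C j) * (‖f k x‖ ^ 2 * ρ x) := by
        refine mul_le_mul_of_nonneg_left (Finset.sum_le_sum fun k hk => ?_) (by positivity)
        have hCk := Finset.single_le_sum (f := C) (fun j _ => hC j) hk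
        have := (hρ.1 x).le
        calc (|mobiusCoeff c ρ n k x| * ‖f k x‖) ^ 2
            = mobiusCoeff c ρ n k x ^ 2 * ‖f k x‖ ^ 2 := by rw [mul_pow, sq_abs]
          _ ≤ (C k * ρ x) * ‖f k x‖ ^ 2 := by gcongr; exact h k x
          _ ≤ ((∑ j ∈ Finset.range (n + 1), C j) * ρ x) * ‖f k x‖ ^ 2 := by gcongr
          _ = _ := by ring
    _ = _ := by rw [← Finset.mul_sum]; ring

/-- As `s w` is nearly dominated too, `|s w f|² ≤ C |f|² ρ`. Then `|w f| = s⁻¹ |s w f| ≤ s⁻¹ (1 + |s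
w f|²)`, where `s⁻¹` is both integrable and bounded. -/
theorem integrable_smul_of_isNearlyDominated (hc : 0 < c) (hρ : ∀ x, 0 < ρ x) {w : 𝓢(ℝ, ℝ)}
    (hw : IsNearlyDominated ρ w) {f : ℝ → ℂ} (hf : AEStronglyMeasurable f volume)
    (hf2 : Integrable fun x => ‖f x‖ ^ 2 * ρ x) : Integrable fun x => w x • f x := by
  obtain ⟨C, hC, h⟩ := (hw.smulLeft hρ (hasTemperateGrowth_mobiusSpeed (c := c))).sq_le
  refine ((integrable_inv_mobiusSpeed hc).add (hf2.const_mul (2 / c * C))).mono'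
    (w.continuous.aestronglyMeasurable.smul hf) (ae_of_all _ fun x => ?_)
  have hp := mobiusSpeed_pos hc x
  have hx := h x
  rw [SchwartzMap.smulLeftCLM_apply_apply hasTemperateGrowth_mobiusSpeed, smul_eq_mul] at hx
  set t := mobiusSpeed c x * (|w x| * ‖f x‖) with ht
  have ht2 : t ^ 2 ≤ C * (‖f x‖ ^ 2 * ρ x) := by
    calc t ^ 2 = (mobiusSpeed c x * w x) ^ 2 * ‖f x‖ ^ 2 := by
          rw [ht, mul_pow, mul_pow, sq_abs]; ring
      _ ≤ (C * ρ x) * ‖f x‖ ^ 2 := by gcongr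
      _ = _ := by ring
  have hρx := (hρ x).le
  calc ‖w x • f x‖ = (mobiusSpeed c x)⁻¹ * t := by
        rw [norm_smul, Real.norm_eq_abs, ht, inv_mul_cancel_left₀ hp.ne']
    _ ≤ (mobiusSpeed c x)⁻¹ * (1 + t ^ 2) := by
        gcongr; nlinarith [sq_nonneg (t - 1)]
    _ = (mobiusSpeed c x)⁻¹ + (mobiusSpeed c x)⁻¹ * t ^ 2 := by ring
    _ ≤ (mobiusSpeed c x)⁻¹ + 2 / c * (C * (‖f x‖ ^ 2 * ρ x)) := by
        gcongr; exact inv_mobiusSpeed_le hc x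
    _ = _ := by simp only [Pi.add_apply]; ring

theorem integrable_mobiusDeriv (hc : 0 < c) (hρ : IsMonotonicSchwartzWeight ρ)
    {f : ℕ → ℝ → ℂ} {n : ℕ} (hf : ∀ k ≤ n, AEStronglyMeasurable (f k) volume)
    (hf2 : ∀ k ≤ n, Integrable fun x => ‖f k x‖ ^ 2 * ρ x) :
    Integrable (mobiusDeriv c ρ f n) := by
  unfold mobiusDeriv
  refine integrable_finsetSum _ fun k hk => ?_
  have hk := Nat.lt_succ_iff.1 (Finset.mem_range.1 hk)
  exact integrable_smul_of_isNearlyDominated hc hρ.1 (isNearlyDominated_mobiusCoeff hρ n k)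
    (hf k hk) (hf2 k hk)

theorem Integrable.inv_mobiusSpeed_smul {E : Type*} [NormedAddCommGroup E] [NormedSpace ℝ E]
    (hc : 0 < c) {G : ℝ → E} (hG : Integrable G) :
    Integrable fun x => (mobiusSpeed c x)⁻¹ • G x := by
  refine hG.bdd_smul (2 / c) ?_ (ae_of_all _ fun x => ?_)
  · exact (continuous_mobiusSpeed.inv₀ fun x => (mobiusSpeed_pos hc x).ne').aestronglyMeasurable
  · rw [Real.norm_of_nonneg (inv_nonneg.2 (mobiusSpeed_pos hc x).le)]
    exact inv_mobiusSpeed_le hc x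

theorem integrableOn_comp_mobiusAngle {E : Type*} [NormedAddCommGroup E] [NormedSpace ℝ E]
    (hc : 0 < c) {G : ℝ → E} (hG : Integrable G) :
    IntegrableOn (fun θ => G (mobiusAngle c θ)) (Ioo 0 (2 * Real.pi)) := by
  rw [integrableOn_Ioo_iff_integrable_mobiusInv hc]
  simp only [mobiusAngle_mobiusInv hc]
  exact Integrable.inv_mobiusSpeed_smul hc hG

/-- The `L²` bound for the derivatives of the Möbius transform. -/
theorem exists_memLp_eLpNorm_mobiusDeriv_le (hc : 0 < c) (hρ : IsMonotonicSchwartzWeight ρ)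
    (n : ℕ) : ∃ C, 0 < C ∧ ∀ f : ℕ → ℝ → ℂ,
      (∀ k ≤ n, AEStronglyMeasurable (f k) volume) →
      (∀ k ≤ n, Integrable fun x => ‖f k x‖ ^ 2 * ρ x) →
      MemLp (fun θ => mobiusDeriv c ρ f n (mobiusAngle c θ)) 2
        (volume.restrict (Ioo 0 (2 * Real.pi))) ∧
      eLpNorm (fun θ => mobiusDeriv c ρ f n (mobiusAngle c θ)) 2
        (volume.restrict (Ioo 0 (2 * Real.pi))) ≤
        ENNReal.ofReal (C * Real.sqrt (∑ k ∈ Finset.range (n + 1), ∫ x, ‖f k x‖ ^ 2 * ρ x)) := by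
  obtain ⟨C, hC, h⟩ := exists_sq_norm_mobiusDeriv_le hρ c n
  -- The factor `2 / c` bounds the Jacobian; the summand `1` keeps the constant positive when `C =
  -- 0`.
  refine ⟨Real.sqrt (2 / c * C + 1), by positivity, fun f hf hf2 => ?_⟩
  have hle : ∀ k ∈ Finset.range (n + 1), k ≤ n := fun k hk =>
    Nat.lt_succ_iff.1 (Finset.mem_range.1 hk)
  have hG := integrable_mobiusDeriv hc hρ hf hf2
  have hS : Integrable fun x => ∑ k ∈ Finset.range (n + 1), ‖f k x‖ ^ 2 * ρ x :=
    integrable_finsetSum _ fun k hk => hf2 k (hle k hk)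
  have hG2 : Integrable fun x => ‖mobiusDeriv c ρ f n x‖ ^ 2 := by
    refine (hS.const_mul C).mono' (hG.aestronglyMeasurable.norm.pow 2) (ae_of_all _ fun x => ?_)
    rw [Real.norm_of_nonneg (by positivity)]
    exact h f x
  have hmem : MemLp (fun θ => mobiusDeriv c ρ f n (mobiusAngle c θ)) 2
      (volume.restrict (Ioo 0 (2 * Real.pi))) := by
    rw [memLp_two_iff_integrable_sq_norm
      (integrableOn_comp_mobiusAngle hc hG).aestronglyMeasurable]
    exact integrableOn_comp_mobiusAngle hc hG2
  refine ⟨hmem, ?_⟩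
  rw [hmem.eLpNorm_eq_integral_rpow_norm two_ne_zero ENNReal.ofNat_ne_top]
  refine ENNReal.ofReal_le_ofReal ?_
  have hS0 : 0 ≤ ∑ k ∈ Finset.range (n + 1), ∫ x, ‖f k x‖ ^ 2 * ρ x :=
    Finset.sum_nonneg fun k _ => integral_nonneg fun x =>
      mul_nonneg (by positivity) (hρ.1 x).le
  rw [← Real.sqrt_mul (by positivity)]
  simp only [ENNReal.toReal_ofNat, Real.rpow_ofNat]
  rw [← one_div, ← Real.sqrt_eq_rpow]
  refine Real.sqrt_le_sqrt ?_
  rw [setIntegral_Ioo_eq_integral_mobiusInv hc]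
  simp only [mobiusAngle_mobiusInv hc, smul_eq_mul]
  calc ∫ x, (mobiusSpeed c x)⁻¹ * ‖mobiusDeriv c ρ f n x‖ ^ 2
      ≤ ∫ x, 2 / c * (C * ∑ k ∈ Finset.range (n + 1), ‖f k x‖ ^ 2 * ρ x) := by
        refine integral_mono (Integrable.inv_mobiusSpeed_smul hc hG2)
          ((hS.const_mul C).const_mul _) fun x => ?_
        have h1 := inv_mobiusSpeed_le hc x
        have h2 := h f x
        have h3 := (mobiusSpeed_pos hc x).le
        dsimp only
        gcongr
    _ = 2 / c * C * ∑ k ∈ Finset.range (n + 1), ∫ x, ‖f k x‖ ^ 2 * ρ x := by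
        rw [integral_const_mul, integral_const_mul,
          integral_finsetSum _ fun k hk => hf2 k (hle k hk), mul_assoc]
    _ ≤ _ := by rw [add_mul]; linarith

end

/-! ### Weak derivatives of the transform and the theorem -/

theorem HasWeakDeriv.isWeakDeriv_weakDeriv {Ω : Set ℝ} {n : ℕ} {u : ℝ → ℂ}
    (h : HasWeakDeriv Ω n u) : IsWeakDeriv Ω n u (weakDeriv Ω n u) := by
  rw [weakDeriv, dif_pos h]
  exact h.choose_spec

theorem IsWeakDeriv.zero {Ω : Set ℝ} {u : ℝ → ℂ} (hu : LocallyIntegrableOn u Ω volume) :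
    IsWeakDeriv Ω 0 u u :=
  ⟨hu, hu, fun ψ _ _ _ => by simp⟩

/-- Testing `v` against `χ'` links consecutive weak derivatives of `u`, each defined from `u` alone.
-/
theorem IsWeakDeriv.integral_smul_eq_neg {n : ℕ} {u v w : ℝ → ℂ} (hv : IsWeakDeriv univ n u v)
    (hw : IsWeakDeriv univ (n + 1) u w) {χ : ℝ → ℝ} (h1 : ContDiff ℝ ∞ χ)
    (h2 : HasCompactSupport χ) : ∫ x, χ x • w x = -∫ x, deriv χ x • v x := by
  have e1 := hw.2.2 χ h1 h2 (subset_univ _)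
  have e2 := hv.2.2 (deriv χ) (contDiff_infty_iff_deriv.1 h1).2 h2.deriv (subset_univ _)
  simp only [Measure.restrict_univ] at e1 e2
  rw [e1, e2, iteratedDeriv_succ', pow_succ]
  ring

section

variable {c : ℝ} {ρ : 𝓢(ℝ, ℝ)} {f : ℝ → ℂ} {α : ℕ}

theorem isWeakDeriv_weakDeriv_of_mem_weightedSobolev (hf : f ∈ weightedSobolev α ρ) {k : ℕ}
    (hk : k ≤ α) : IsWeakDeriv univ k f (weakDeriv univ k f) :=
  (hf k hk).1.isWeakDeriv_weakDeriv

theorem locallyIntegrable_weakDeriv (hf : f ∈ weightedSobolev α ρ) {k : ℕ} (hk : k ≤ α) :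
    LocallyIntegrable (weakDeriv univ k f) volume :=
  locallyIntegrableOn_univ.1 (isWeakDeriv_weakDeriv_of_mem_weightedSobolev hf hk).2.1

/-- Being a chosen representative, the derivative of order zero need not equal `f` pointwise. -/
theorem weakDeriv_zero_ae_eq (hf : f ∈ weightedSobolev α ρ) :
    weakDeriv univ 0 f =ᵐ[volume] f := by
  have h := isWeakDeriv_weakDeriv_of_mem_weightedSobolev hf (Nat.zero_le _)
  simpa using h.ae_eq isOpen_univ (IsWeakDeriv.zero h.1)

theorem mobiusTransform_mobiusInv (hc : 0 < c) (x : ℝ) :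
    mobiusTransform c ρ f (mobiusInv c x) = (mobiusSpeed c x * ρ x) • f x := by
  rw [mobiusTransform, (hasDerivAt_mobiusAngle hc (mobiusInv_mem x)).deriv,
    mobiusAngle_mobiusInv hc, Complex.real_smul]
  push_cast
  ring

theorem integrable_mobiusDeriv_weakDeriv (hc : 0 < c) (hρ : IsMonotonicSchwartzWeight ρ)
    (hf : f ∈ weightedSobolev α ρ) {n : ℕ} (hn : n ≤ α) :
    Integrable (mobiusDeriv c ρ (fun k => weakDeriv univ k f) n) :=
  integrable_mobiusDeriv hc hρ
    (fun _ hk => (locallyIntegrable_weakDeriv hf (hk.trans hn)).aestronglyMeasurable)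
    (fun k hk => (hf k (hk.trans hn)).2)

theorem mobiusTransform_mobiusInv_ae_eq (hc : 0 < c) (hf : f ∈ weightedSobolev α ρ) :
    (fun x => mobiusTransform c ρ f (mobiusInv c x)) =ᵐ[volume]
      mobiusDeriv c ρ (fun k => weakDeriv univ k f) 0 := by
  filter_upwards [weakDeriv_zero_ae_eq hf] with x hx
  rw [mobiusTransform_mobiusInv hc, mobiusDeriv_zero, hx]

theorem integrableOn_mobiusTransform (hc : 0 < c) (hρ : IsMonotonicSchwartzWeight ρ)
    (hf : f ∈ weightedSobolev α ρ) :
    IntegrableOn (mobiusTransform c ρ f) (Ioo 0 (2 * Real.pi)) := by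
  rw [integrableOn_Ioo_iff_integrable_mobiusInv hc]
  exact Integrable.inv_mobiusSpeed_smul hc
    ((integrable_mobiusDeriv_weakDeriv hc hρ hf (Nat.zero_le _)).congr
      (mobiusTransform_mobiusInv_ae_eq hc hf).symm)

theorem setIntegral_smul_mobiusDeriv (hc : 0 < c) (hf : f ∈ weightedSobolev α ρ) (n : ℕ)
    (hn : n ≤ α) : ∀ ψ : ℝ → ℝ, ContDiff ℝ ∞ ψ → HasCompactSupport ψ →
      tsupport ψ ⊆ Ioo 0 (2 * Real.pi) →
      ∫ θ in Ioo 0 (2 * Real.pi),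
          ψ θ • mobiusDeriv c ρ (fun k => weakDeriv univ k f) n (mobiusAngle c θ) =
        (-1 : ℂ) ^ n * ∫ θ in Ioo 0 (2 * Real.pi),
          iteratedDeriv n ψ θ • mobiusTransform c ρ f θ := by
  induction n with
  | zero =>
    intro ψ h1 h2 h3
    rw [pow_zero, one_mul, iteratedDeriv_zero, setIntegral_smul_comp_mobiusAngle hc,
      setIntegral_Ioo_eq_integral_mobiusInv hc]
    refine integral_congr_ae ?_
    filter_upwards [mobiusTransform_mobiusInv_ae_eq hc hf] with x hx
    rw [hx, smul_comm]
  | succ n ih =>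
    intro ψ h1 h2 h3
    rw [setIntegral_smul_comp_mobiusAngle_eq_neg hc (fun χ k1 k2 =>
      integral_smul_mobiusDeriv_succ hc
        (fun k hk => locallyIntegrable_weakDeriv hf (hk.trans hn))
        (fun k hk χ h1 h2 => (isWeakDeriv_weakDeriv_of_mem_weightedSobolev hf
          (by omega)).integral_smul_eq_neg (isWeakDeriv_weakDeriv_of_mem_weightedSobolev hf
          (by omega)) h1 h2) k1 k2) h1 h2 h3,
      ih (by omega) (deriv ψ) (contDiff_infty_iff_deriv.1 h1).2 h2.deriv
        (tsupport_deriv_subset.trans h3), iteratedDeriv_succ', pow_succ]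
    ring

/-- The weak derivatives of the Möbius transform; the composition with `mobiusAngle c` may be
taken with any representative. -/
theorem isWeakDeriv_mobiusTransform (hc : 0 < c) (hρ : IsMonotonicSchwartzWeight ρ)
    (hf : f ∈ weightedSobolev α ρ) {n : ℕ} (hn : n ≤ α) {H h : ℝ → ℂ}
    (hH : H =ᵐ[volume] mobiusDeriv c ρ (fun k => weakDeriv univ k f) n)
    (hh : EqOn h (fun θ => H (mobiusAngle c θ)) (Ioo 0 (2 * Real.pi))) :
    IsWeakDeriv (Ioo 0 (2 * Real.pi)) n (mobiusTransform c ρ f) h := by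
  refine ⟨(integrableOn_mobiusTransform hc hρ hf).locallyIntegrableOn, ?_, fun ψ h1 h2 h3 => ?_⟩
  · exact ((integrableOn_comp_mobiusAngle hc
      ((integrable_mobiusDeriv_weakDeriv hc hρ hf hn).congr hH.symm)).congr_fun
      hh.symm measurableSet_Ioo).locallyIntegrableOn
  · rw [← setIntegral_smul_mobiusDeriv hc hf n hn ψ h1 h2 h3, setIntegral_smul_comp_mobiusAngle hc,
      setIntegral_congr_fun (g := fun θ => ψ θ • H (mobiusAngle c θ)) measurableSet_Ioo
        fun θ hθ => by simp only [hh hθ], setIntegral_smul_comp_mobiusAngle hc]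
    refine integral_congr_ae ?_
    filter_upwards [hH] with x hx
    rw [hx]

theorem exists_continuous_ae_eq_mobiusDeriv (hc : 0 < c) (hρ : IsMonotonicSchwartzWeight ρ)
    (hf : f ∈ weightedSobolev α ρ) {n : ℕ} (hn : n < α) :
    ∃ H : ℝ → ℂ, Continuous H ∧
      H =ᵐ[volume] mobiusDeriv c ρ (fun k => weakDeriv univ k f) n ∧
      Tendsto H atTop (𝓝 0) ∧ Tendsto H atBot (𝓝 0) :=
  exists_continuous_ae_eq_tendsto_zero (integrable_mobiusDeriv_weakDeriv hc hρ hf hn.le)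
    (Integrable.inv_mobiusSpeed_smul hc (integrable_mobiusDeriv_weakDeriv hc hρ hf hn))
    fun χ k1 k2 => integral_smul_mobiusDeriv_succ hc
        (fun k hk => locallyIntegrable_weakDeriv hf (hk.trans hn))
        (fun k hk χ h1 h2 => (isWeakDeriv_weakDeriv_of_mem_weightedSobolev hf
          (by omega)).integral_smul_eq_neg (isWeakDeriv_weakDeriv_of_mem_weightedSobolev hf
          (by omega)) h1 h2) k1 k2

end

theorem mainTheorem2 (c : ℝ) (hc : 0 < c) (ρ : 𝓢(ℝ, ℝ)) (hρ : IsMonotonicSchwartzWeight ρ) :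
    (∀ τ : ℕ, ∃ C : ℝ, 0 < C ∧ ∀ α : ℕ, 1 ≤ α → τ ≤ α → ∀ f ∈ weightedSobolev α ρ,
      HasWeakDeriv (Ioo 0 (2 * Real.pi)) τ (mobiusTransform c ρ f) ∧
      eLpNorm (weakDeriv (Ioo 0 (2 * Real.pi)) τ (mobiusTransform c ρ f)) 2
          (volume.restrict (Ioo 0 (2 * Real.pi)))
        ≤ ENNReal.ofReal (C * weightedSobolevNorm α ρ f)) ∧
    (∀ α : ℕ, 1 ≤ α → ∀ f ∈ weightedSobolev α ρ,
      (∀ τ < α,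
        (∃ h : ℝ → ℂ, IsWeakDeriv (Ioo 0 (2 * Real.pi)) τ (mobiusTransform c ρ f) h ∧
          ContinuousOn h (Ioo 0 (2 * Real.pi))) ∧
        ∀ h : ℝ → ℂ, IsWeakDeriv (Ioo 0 (2 * Real.pi)) τ (mobiusTransform c ρ f) h →
          ContinuousOn h (Ioo 0 (2 * Real.pi)) →
          Tendsto h (𝓝[>] 0) (𝓝 0) ∧ Tendsto h (𝓝[<] (2 * Real.pi)) (𝓝 0)) ∧
      mobiusTransform c ρ f ∈ periodicSobolev α) := by
  have hpi : (0 : ℝ) < 2 * Real.pi := by positivity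
  have weak : ∀ {α τ : ℕ} {f : ℝ → ℂ}, τ ≤ α → f ∈ weightedSobolev α ρ →
      IsWeakDeriv (Ioo 0 (2 * Real.pi)) τ (mobiusTransform c ρ f)
        (fun θ => mobiusDeriv c ρ (fun k => weakDeriv univ k f) τ (mobiusAngle c θ)) :=
    fun hτ hf => isWeakDeriv_mobiusTransform hc hρ hf hτ EventuallyEq.rfl fun _ _ => rfl
  have weak_ae : ∀ {α τ : ℕ} {f : ℝ → ℂ}, τ ≤ α → f ∈ weightedSobolev α ρ →
      weakDeriv (Ioo 0 (2 * Real.pi)) τ (mobiusTransform c ρ f)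
        =ᵐ[volume.restrict (Ioo 0 (2 * Real.pi))]
        (fun θ => mobiusDeriv c ρ (fun k => weakDeriv univ k f) τ (mobiusAngle c θ)) :=
    fun hτ hf => (HasWeakDeriv.isWeakDeriv_weakDeriv ⟨_, weak hτ hf⟩).ae_eq isOpen_Ioo
      (weak hτ hf)
  refine ⟨fun τ => ?_, fun α _ f hf => ⟨fun τ hτ => ?_, fun τ hτ => ⟨⟨_, weak hτ hf⟩, ?_⟩,
    fun τ hτ => ?_⟩⟩
  · obtain ⟨C, hC, h⟩ := exists_memLp_eLpNorm_mobiusDeriv_le hc hρ τ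
    refine ⟨C, hC, fun α _ hτ f hf => ⟨⟨_, weak hτ hf⟩, ?_⟩⟩
    rw [eLpNorm_congr_ae (weak_ae hτ hf)]
    refine (h _ (fun k hk => (locallyIntegrable_weakDeriv hf (hk.trans hτ)).aestronglyMeasurable)
      (fun k hk => (hf k (hk.trans hτ)).2)).2.trans (ENNReal.ofReal_le_ofReal ?_)
    refine mul_le_mul_of_nonneg_left (Real.sqrt_le_sqrt ?_) hC.le
    refine Finset.sum_le_sum_of_subset_of_nonneg
      (Finset.range_mono (Nat.succ_le_succ hτ)) fun k _ _ => ?_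
    exact integral_nonneg fun x => mul_nonneg (by positivity) (hρ.1 x).le
  · obtain ⟨H, hHc, hH, htop, hbot⟩ := exists_continuous_ae_eq_mobiusDeriv hc hρ hf hτ
    have hw := isWeakDeriv_mobiusTransform hc hρ hf hτ.le hH fun _ _ => rfl
    have hcont : ContinuousOn (fun θ => H (mobiusAngle c θ)) (Ioo 0 (2 * Real.pi)) :=
      hHc.comp_continuousOn (continuousOn_mobiusAngle hc)
    refine ⟨⟨_, hw, hcont⟩, fun h hh hhc => ?_⟩
    -- Continuous functions equal almost everywhere on an open set coincide there, so the limits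
    -- hold for every continuous representative.
    have heq : EqOn h (fun θ => H (mobiusAngle c θ)) (Ioo 0 (2 * Real.pi)) :=
      Measure.eqOn_open_of_ae_eq (hh.ae_eq isOpen_Ioo hw) isOpen_Ioo hhc hcont
    constructor
    · refine (hbot.comp (tendsto_mobiusAngle_nhdsGT_zero hc)).congr' ?_
      filter_upwards [Ioo_mem_nhdsGT hpi] with θ hθ using (heq hθ).symm
    · refine (htop.comp (tendsto_mobiusAngle_nhdsLT_two_pi hc)).congr' ?_
      filter_upwards [Ioo_mem_nhdsLT hpi] with θ hθ using (heq hθ).symm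
  · obtain ⟨C, -, h⟩ := exists_memLp_eLpNorm_mobiusDeriv_le hc hρ τ
    exact (memLp_congr_ae (weak_ae hτ hf)).2 (h _
      (fun k hk => (locallyIntegrable_weakDeriv hf (hk.trans hτ)).aestronglyMeasurable)
      (fun k hk => (hf k (hk.trans hτ)).2)).1
  · obtain ⟨H, hHc, hH, htop, hbot⟩ := exists_continuous_ae_eq_mobiusDeriv hc hρ hf hτ
    have hcont : ContinuousOn (fun θ => H (mobiusAngle c θ)) (Ioo 0 (2 * Real.pi)) :=
      hHc.comp_continuousOn (continuousOn_mobiusAngle hc)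
    have h0 : Tendsto (fun θ => H (mobiusAngle c θ)) (𝓝[>] 0) (𝓝 0) :=
      hbot.comp (tendsto_mobiusAngle_nhdsGT_zero hc)
    have h1 : Tendsto (fun θ => H (mobiusAngle c θ)) (𝓝[<] (2 * Real.pi)) (𝓝 0) :=
      htop.comp (tendsto_mobiusAngle_nhdsLT_two_pi hc)
    -- Extending by the limits gives continuity on the closed interval and the value zero at both
    -- ends.
    refine ⟨extendFrom (Ioo 0 (2 * Real.pi)) fun θ => H (mobiusAngle c θ),
      isWeakDeriv_mobiusTransform hc hρ hf hτ.le hH fun θ hθ => ?_,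
      continuousOn_Icc_extendFrom_Ioo hcont h0 h1, ?_⟩
    · exact extendFrom_eq (subset_closure hθ) (hcont θ hθ)
    · rw [eq_lim_at_left_extendFrom_Ioo hpi h0, eq_lim_at_right_extendFrom_Ioo hpi h1]
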